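/- **Conventions.** A *dynamical system* $(X,s)$ is a non-empty compact Hausdorff space $X$ with a homeomorphism $s\colon X\to X$. A system $(Y,t)$ is a *factor* of $(X,s)$ if there is a continuous surjection $\pi\colon X\to Y$ with $\pi\circ s=t\circ\pi$. The system $(X,s)$ is *minimal* if the only non-empty closed $A\subseteq X$ with $s(A)=A$ is $A=X$. It is *uniquely ergodic* if there is exactly one regular Borel probability measure $\mu$ on $X$ with $\mu(s^{-1}(B))=\mu(B)$ for all Borel $B\subseteq X$. Let $\mathbb{T}=\{z\in\mathbb{C}:|z|=1\}$. Let $G_0(X,s)$ be the set of constant functions $X\to\mathbb{T}$ and, for $m\ge 0$, let $G_{m+1}(X,s)$ be the set of continuous $g\colon X\to\mathbb{T}$ such that $g\circ s=f\cdot g$ for some $f\in G_m(X,s)$. The system $(X,s)$ has (topological) *quasi-discrete spectrum* if the linear span of $\bigcup_{m\ge0}G_m(X,s)$ is dense in $C(X,\mathbb{C})$ for the supremum norm. Let $H(\mathbb{T})$ be the compact abelian group of all (not necessarily continuous) group homomorphisms $\mathbb{T}\to\mathbb{T}$, with pointwise multiplication and the topology of pointwise convergence, and let $\mathbb{T}_Q=\{e^{2\pi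 i q}:q\in\mathbb{Q}\}$. Let $s(k,j)$ be the signed Stirling numbers of the first kind, $x(x-1)\cdots(x-k+1)=\sum_{j=0}^k s(k,j)x^j$. Let $\mathcal{H}$ be the set of all sequences $(\phi_k)_{k\ge0}$ in $H(\mathbb{T})$ such that $\phi_0=\mathrm{id}_{\mathbb{T}}$ and $$\phi_k(x^{k!})=\prod_{j=1}^k\phi_1^{(j)}\bigl(x^{s(k,j)}\bigr)\qquad\text{for all }x\in\mathbb{T}_Q,\ k\ge1,$$ where $\phi_1^{(j)}$ is the $j$-fold composition of $\phi_1$ with itself. Then $\mathcal{H}$ is a closed subset of the product space $H(\mathbb{T})^{\mathbb{Z}_{\ge0}}$, and $$T(\phi_0,\phi_1,\phi_2,\dots)=(\phi_0,\ \phi_0\phi_1,\ \phi_1\phi_2,\ \dots)$$ restricts to a homeomorphism $T\colon\mathcal{H}\to\mathcal{H}$, so that $(\mathcal{H},T)$ is a dynamical system. **Theorem.** Every factor of $(\mathcal{H},T)$ is uniquely ergodic. In particular, every minimal dynamical system with topological quasi-discrete spectrum is uniquely ergodic. -/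

import Mathlib

open Set Topology MeasureTheory

namespace QuasiDiscrete

/-! ### Topological dynamics

A dynamical system is a compact Hausdorff space `X` with a homeomorphism `s : X ≃ₜ X`. -/

section Dynamics

variable {X Y : Type*} [TopologicalSpace X] [TopologicalSpace Y]

/-- `(Y, t)` is a factor of `(X, s)`: there is a continuous surjection `π : X → Y` with
`π ∘ s = t ∘ π`. -/
def IsFactor (s : X ≃ₜ X) (t : Y ≃ₜ Y) : Prop :=
  ∃ π : X → Y, Continuous π ∧ Function.Surjective π ∧ π ∘ s = t ∘ π

/-- `(X, s)` is minimal: there is no proper non-empty closed set `A` with `s(A) = A`. -/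
def IsMinimalSystem (s : X ≃ₜ X) : Prop :=
  ∀ A : Set X, IsClosed A → A.Nonempty → s '' A = A → A = univ

/-- A regular Borel probability measure `μ` with `μ (s⁻¹ B) = μ B` for all Borel sets `B`. -/
structure IsInvariantMeasure [MeasurableSpace X] (s : X ≃ₜ X) (μ : Measure X) : Prop where
  prob : IsProbabilityMeasure μ
  regular : μ.Regular
  invariant : ∀ B : Set X, MeasurableSet B → μ (s ⁻¹' B) = μ B

/-- There is exactly one invariant measure. -/
def UniquelyErgodic [MeasurableSpace X] (s : X ≃ₜ X) : Prop :=
  ∃! μ : Measure X, IsInvariantMeasure s μ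

/-- The sets `G_m(X, s)` of continuous functions `X → 𝕋`: `G_0(X, s)` consists of the constants,
and `g ∈ G_{m+1}(X, s)` iff `g ∘ s = f g` for some `f ∈ G_m(X, s)`. -/
def quasiEigenfunctions (s : X ≃ₜ X) : ℕ → Set C(X, Circle)
  | 0 => {g | ∃ c : Circle, ∀ x, g x = c}
  | m + 1 => {g | ∃ f ∈ quasiEigenfunctions s m, ∀ x, g (s x) = f x * g x}

/-- `(X, s)` has quasi-discrete spectrum: the complex linear span of the set of all
quasi-eigenfunctions is dense in `C(X, ℂ)` (for compact `X`, the topology of `C(X, ℂ)` is that of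
the supremum norm). -/
def HasQuasiDiscreteSpectrum (s : X ≃ₜ X) : Prop :=
  Dense (Submodule.span ℂ {f : C(X, ℂ) | ∃ m : ℕ, ∃ g ∈ quasiEigenfunctions s m,
    ∀ x, f x = (g x : ℂ)} : Set C(X, ℂ))

end Dynamics

/-! ### The endomorphism group of the circle -/

/-- The group `H(𝕋)` of all (not necessarily continuous) homomorphisms `𝕋 → 𝕋`, with
pointwise multiplication. -/
abbrev CircleEnd : Type := Circle →* Circle

/-- The topology of pointwise convergence on `H(𝕋)`, i.e. the one induced from `𝕋^𝕋`. -/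
noncomputable instance instTopologicalSpaceCircleEnd : TopologicalSpace CircleEnd :=
  TopologicalSpace.induced (fun φ x => φ x) (inferInstance : TopologicalSpace (Circle → Circle))

theorem continuous_eval (x : Circle) : Continuous fun φ : CircleEnd => φ x :=
  (continuous_apply x).comp continuous_induced_dom

theorem continuous_circleEnd {Z : Type*} [TopologicalSpace Z] {f : Z → CircleEnd}
    (h : ∀ x, Continuous fun z => f z x) : Continuous f :=
  continuous_induced_rng.2 (continuous_pi h)

instance instIsTopologicalGroupCircleEnd : IsTopologicalGroup CircleEnd where
  continuous_mul := continuous_circleEnd fun x =>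
    ((continuous_eval x).comp continuous_fst).mul ((continuous_eval x).comp continuous_snd)
  continuous_inv := continuous_circleEnd fun x => (continuous_eval x).inv

/-! ### The map `A_G` on `G^{ℤ₊}` -/

section SkewShift

variable {G : Type*} [CommGroup G]

/-- `A_G (g₀, g₁, g₂, …) = (g₀, g₀ g₁, g₁ g₂, …)`. -/
def skewFun (g : ℕ → G) : ℕ → G
  | 0 => g 0
  | k + 1 => g k * g (k + 1)

/-- The inverse of `skewFun`. -/
def skewInv (g : ℕ → G) : ℕ → G
  | 0 => g 0
  | k + 1 => (skewInv g k)⁻¹ * g (k + 1)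

/-- `A_G` as a homeomorphism of `G^{ℤ₊}`, for a commutative topological group `G`. -/
def skewShift (G : Type*) [CommGroup G] [TopologicalSpace G] [IsTopologicalGroup G] :
    (ℕ → G) ≃ₜ (ℕ → G) where
  toFun := skewFun
  invFun := skewInv
  left_inv g := by
    funext k
    induction k with
    | zero => rfl
    | succ k ih => simp [skewInv, ih, skewFun]
  right_inv g := by
    funext k
    cases k with
    | zero => rfl
    | succ k => simp [skewInv, skewFun]
  continuous_toFun := continuous_pi fun k => by
    cases k with
    | zero => exact continuous_apply 0
    | succ k => exact (continuous_apply k).mul (continuous_apply (k + 1))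
  continuous_invFun := continuous_pi fun k => by
    induction k with
    | zero => exact continuous_apply 0
    | succ k ih => exact ih.inv.mul (continuous_apply (k + 1))

end SkewShift

/-! ### The system `(𝓗, T)` -/

/-- `𝕋_Q = {e^{2πiq} : q ∈ ℚ}`. -/
def circleQ : Set Circle := {x | ∃ q : ℚ, x = Circle.exp (2 * Real.pi * (q : ℝ))}

/-- The signed Stirling number of the first kind `s(k, j)`: the coefficient of `X ^ j` in
`X (X - 1) ⋯ (X - k + 1)`. -/
noncomputable def stirling (k j : ℕ) : ℤ := (descPochhammer ℤ k).coeff j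

/-- The set `𝓗` of all sequences `(φ_k)_{k ≥ 0}` in `H(𝕋)` such that `φ_0` is the identity and
`φ_k (x ^ k!) = ∏_{j=1}^k φ_1^{(j)} (x ^ s(k, j))` for all `x ∈ 𝕋_Q` and `k ≥ 1`, where `φ_1^{(j)}`
is the `j`-fold composition of `φ_1` with itself. -/
def weylSet : Set (ℕ → CircleEnd) :=
  {φ | φ 0 = MonoidHom.id Circle ∧
    ∀ k : ℕ, 1 ≤ k → ∀ x ∈ circleQ,
      φ k (x ^ k.factorial) = ∏ j ∈ Finset.Icc 1 k, (φ 1)^[j] (x ^ stirling k j)}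

theorem isOfFinOrder_of_mem_circleQ {x : Circle} (hx : x ∈ circleQ) : IsOfFinOrder x := by
  obtain ⟨q, rfl⟩ := hx
  refine isOfFinOrder_iff_pow_eq_one.2 ⟨q.den, q.den_pos, ?_⟩
  rw [← Circle.exp_nsmul, Circle.exp_eq_one]
  refine ⟨q.num, ?_⟩
  have h : (q : ℝ) * q.den = q.num := by exact_mod_cast Rat.mul_den_eq_num q
  rw [nsmul_eq_mul, ← h]
  ring

/-- An endomorphism acts on a torsion element of the circle as a power map. -/
theorem exists_apply_eq_zpow (f : CircleEnd) {x : Circle} (hx : IsOfFinOrder x) :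
    ∃ m : ℤ, f x = x ^ m := by
  have hp : IsPrimitiveRoot (Circle.coeHom x) (orderOf x) :=
    (IsPrimitiveRoot.orderOf x).map_of_injective Circle.coe_injective
  have h1 : (Circle.coeHom (f x)) ^ orderOf x = 1 := by
    rw [← map_pow, ← map_pow, pow_orderOf_eq_one, map_one, map_one]
  have : NeZero (orderOf x) := ⟨hx.orderOf_pos.ne'⟩
  obtain ⟨i, -, hi⟩ := hp.eq_pow_of_pow_eq_one h1
  refine ⟨i, Circle.coe_injective ?_⟩
  rw [zpow_natCast]
  exact hi.symm.trans (map_pow Circle.coeHom x i).symm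

theorem iterate_zpow (f : CircleEnd) {x : Circle} {m : ℤ} (h : f x = x ^ m) (j : ℕ) (a : ℤ) :
    f^[j] (x ^ a) = x ^ (a * m ^ j) := by
  induction j with
  | zero => simp
  | succ j ih =>
    rw [Function.iterate_succ_apply', ih, map_zpow, h, ← zpow_mul]
    ring_nf

theorem prod_zpow_eq (x : Circle) (a : ℕ → ℤ) (S : Finset ℕ) :
    ∏ j ∈ S, x ^ a j = x ^ ∑ j ∈ S, a j := by
  induction S using Finset.cons_induction with
  | empty => simp
  | cons j S hj ih => rw [Finset.prod_cons, Finset.sum_cons, ih, zpow_add]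

theorem prod_stirling (f : CircleEnd) {x : Circle} {m : ℤ} (h : f x = x ^ m) {k : ℕ}
    (hk : 1 ≤ k) :
    ∏ j ∈ Finset.Icc 1 k, f^[j] (x ^ stirling k j) = x ^ (descPochhammer ℤ k).eval m := by
  have h0 : (descPochhammer ℤ k).coeff 0 = 0 := by
    rw [Polynomial.coeff_zero_eq_eval_zero]
    exact descPochhammer_ne_zero_eval_zero ℤ (by omega)
  have hd : (descPochhammer ℤ k).natDegree = k := descPochhammer_natDegree ℤ k
  rw [Polynomial.eval_eq_sum_range, hd, Finset.sum_range_succ', h0, zero_mul, add_zero]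
  simp only [iterate_zpow f h, stirling]
  rw [prod_zpow_eq, Finset.range_eq_Ico, Finset.sum_Ico_add' (fun j =>
    (descPochhammer ℤ k).coeff j * m ^ j) 0 k 1]
  rfl

theorem mem_weylSet_iff (φ : ℕ → CircleEnd) :
    φ ∈ weylSet ↔ φ 0 = MonoidHom.id Circle ∧ ∀ x ∈ circleQ, ∀ m : ℤ, φ 1 x = x ^ m →
      ∀ k : ℕ, φ k (x ^ k.factorial) = x ^ (descPochhammer ℤ k).eval m := by
  constructor
  · rintro ⟨h0, h⟩
    refine ⟨h0, fun x hx m hm k => ?_⟩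
    rcases Nat.eq_zero_or_pos k with rfl | hk
    · simp [h0]
    · rw [h k hk x hx, prod_stirling _ hm hk]
  · rintro ⟨h0, h⟩
    refine ⟨h0, fun k hk x hx => ?_⟩
    obtain ⟨m, hm⟩ := exists_apply_eq_zpow (φ 1) (isOfFinOrder_of_mem_circleQ hx)
    rw [h x hx m hm k, prod_stirling _ hm hk]

theorem descPochhammer_eval_sub_one (k : ℕ) (m : ℤ) :
    (descPochhammer ℤ (k + 1)).eval m = (descPochhammer ℤ (k + 1)).eval (m - 1) +
      (descPochhammer ℤ k).eval (m - 1) * (k + 1) := by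
  have h := congrArg (Polynomial.eval m) (descPochhammer_succ_comp_X_sub_one (R := ℤ) k)
  simp only [Polynomial.eval_comp, Polynomial.eval_sub, Polynomial.eval_X, Polynomial.eval_one,
    smul_eq_mul, Polynomial.eval_mul, Polynomial.eval_add, Polynomial.eval_natCast] at h
  linarith

/-- `𝓗` is invariant under `A_{H(𝕋)}` and its inverse. -/
theorem skewShift_mem_weylSet (φ : ℕ → CircleEnd) :
    φ ∈ weylSet ↔ skewShift CircleEnd φ ∈ weylSet := by
  have hz : skewShift CircleEnd φ 0 = φ 0 := rfl
  have hs : ∀ k, skewShift CircleEnd φ (k + 1) = φ k * φ (k + 1) := fun k => rfl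
  have hf : ∀ (k : ℕ) (x : Circle), x ^ (k + 1).factorial = (x ^ k.factorial) ^ (k + 1) :=
    fun k x => by rw [← pow_mul, Nat.factorial_succ, mul_comm]
  rw [mem_weylSet_iff, mem_weylSet_iff, hz]
  refine and_congr_right fun h0 => forall₂_congr fun x hx => ?_
  have h1 : skewShift CircleEnd φ 1 x = x * φ 1 x := by
    rw [show (1 : ℕ) = 0 + 1 from rfl, hs, MonoidHom.mul_apply, h0]
    rfl
  constructor
  · intro h m hm k
    have hm' : φ 1 x = x ^ (m - 1) := by
      rw [zpow_sub_one, ← hm, h1, mul_comm x, mul_inv_cancel_right]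
    cases k with
    | zero => simp [hz, h0]
    | succ k =>
      rw [hs, MonoidHom.mul_apply, h _ hm' (k + 1), hf, map_pow, h _ hm' k,
        descPochhammer_eval_sub_one k m, zpow_add, zpow_mul, mul_comm]
      norm_cast
  · intro h m hm k
    have hm' : skewShift CircleEnd φ 1 x = x ^ (m + 1) := by
      rw [h1, hm, zpow_add_one, mul_comm]
    induction k with
    | zero => simp [h0]
    | succ k ih =>
      have h2 := h _ hm' (k + 1)
      rw [hs, MonoidHom.mul_apply, hf, map_pow, ih, descPochhammer_eval_sub_one k (m + 1),
        add_sub_cancel_right, zpow_add, zpow_mul, mul_comm] at h2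
      rw [hf]
      exact mul_right_cancel (h2.trans (by norm_cast))

/-! `(𝓗, T)` is a dynamical system: `𝓗` is a compact Hausdorff space. -/

instance instT2SpaceCircleEnd : T2Space CircleEnd :=
  T2Space.of_injective_continuous (f := fun (φ : CircleEnd) (x : Circle) => φ x)
    DFunLike.coe_injective continuous_induced_dom

instance instCompactSpaceCircleEnd : CompactSpace CircleEnd := by
  have hi : IsInducing fun (φ : CircleEnd) (x : Circle) => φ x := ⟨rfl⟩
  have hr : range (fun (φ : CircleEnd) (x : Circle) => φ x) =
      {f : Circle → Circle | ∀ x y, f (x * y) = f x * f y} := by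
    ext f
    constructor
    · rintro ⟨φ, rfl⟩ x y
      exact map_mul φ x y
    · exact fun h => ⟨MonoidHom.mk' f h, rfl⟩
  have hc : IsClosed {f : Circle → Circle | ∀ x y, f (x * y) = f x * f y} := by
    simp only [ofPred_forall]
    exact isClosed_iInter fun x => isClosed_iInter fun y => isClosed_eq (continuous_apply _)
      ((continuous_apply x).mul (continuous_apply y))
  refine ⟨hi.isCompact_iff.2 ?_⟩
  rw [image_univ, hr]
  exact hc.isCompact

theorem continuous_iterate {x : Circle} (hx : IsOfFinOrder x) (j : ℕ) (a : ℤ) :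
    Continuous fun φ : CircleEnd => φ^[j] (x ^ a) := by
  induction j with
  | zero => exact continuous_const
  | succ j ih =>
    -- near `φ₀` the value of `φ^[j] (x ^ a)` in the finite set of powers of `x` is constant
    have hfin : (Set.range fun i : ℤ => x ^ i).Finite :=
      finite_zpowers.2 hx
    refine continuous_iff_continuousAt.2 fun φ₀ => ?_
    set y := φ₀^[j] (x ^ a) with hy
    have hopen : ∀ᶠ φ : CircleEnd in 𝓝 φ₀, φ^[j] (x ^ a) = y := by
      have hc : IsClosed ((Set.range fun i : ℤ => x ^ i) \ {y}) := (hfin.subset sdiff_subset).isClosed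
      have := (ih.continuousAt (x := φ₀)).eventually
        (hc.isOpen_compl.mem_nhds (fun h => h.2 rfl))
      filter_upwards [this] with φ hφ
      obtain ⟨m, hm⟩ := exists_apply_eq_zpow φ hx
      by_contra hne
      exact hφ ⟨⟨_, (iterate_zpow φ hm j a).symm⟩, hne⟩
    refine ((continuous_eval y).continuousAt (x := φ₀)).congr ?_
    filter_upwards [hopen] with φ hφ
    rw [Function.iterate_succ_apply', hφ]

theorem isClosed_weylSet : IsClosed weylSet := by
  have h : weylSet = {φ : ℕ → CircleEnd | φ 0 = MonoidHom.id Circle} ∩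
      ⋂ (k : ℕ) (_ : 1 ≤ k) (x : Circle) (_ : x ∈ circleQ), {φ : ℕ → CircleEnd |
        φ k (x ^ k.factorial) = ∏ j ∈ Finset.Icc 1 k, (φ 1)^[j] (x ^ stirling k j)} := by
    ext φ
    simp [weylSet]
  rw [h]
  refine (isClosed_eq (continuous_apply 0) continuous_const).inter ?_
  refine isClosed_iInter fun k => isClosed_iInter fun hk => isClosed_iInter fun x =>
    isClosed_iInter fun hx => isClosed_eq ((continuous_eval _).comp (continuous_apply k)) ?_
  exact continuous_finsetProd _ fun j _ =>
    (continuous_iterate (isOfFinOrder_of_mem_circleQ hx) j _).comp (continuous_apply 1)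

instance instCompactSpaceWeylSet : CompactSpace weylSet :=
  isCompact_iff_compactSpace.1 isClosed_weylSet.isCompact

/-- The map `T` on `𝓗`, i.e. the restriction of `A_{H(𝕋)}`. -/
noncomputable def weylHomeo : weylSet ≃ₜ weylSet :=
  (skewShift CircleEnd).subtype skewShift_mem_weylSet

end QuasiDiscrete

open Filter

/-! Unique ergodicity follows once the Birkhoff averages of every continuous function converge
uniformly to a constant, and it suffices to check this on a set with dense span
(`exists_hasUniformMean_of_dense_span`, `uniquelyErgodic_of_hasUniformMean`). In both settings that
set comes from a group of unimodular functions on which some power of `ratio s` yields a constant,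
so along an orbit they behave like polynomial phases.

Such a g obeys a dichotomy (`ratio_eq_const_or_periodic`). Either, after replacing s by some s^M, an
iterated difference of g is a constant of infinite order, and Weyl's theorem via van der Corput
gives mean 0 uniformly; or g is s^M-invariant for some M > 0. Only the periodic functions depend on
the system.

In a minimal system the sum of a periodic g over M consecutive orbit points is continuous and
invariant, hence constant. On 𝓗 the group consists of the products of evaluations `weylChar d x`.
Periodicity forces the arguments x_k, k ≥ 1, to be torsion, and the Stirling relations then make g a
fixed periodic function of the integer m with φ₁(z) = z^m, for one root of unity z. As T replaces m
by m + 1, averages over a period do not depend on φ. Uniform means descend to factors. -/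

namespace QuasiDiscrete

/-! ### Uniform convergence of Birkhoff averages -/

section UniformMean

variable {X Y E : Type*} [NormedAddCommGroup E] [NormedSpace ℝ E]

/-- The Birkhoff averages of `f` converge uniformly to the constant `c`. -/
def HasUniformMean (s : X → X) (f : X → E) (c : E) : Prop :=
  TendstoUniformly (fun n x => birkhoffAverage ℝ s f n x) (fun _ => c) atTop

theorem HasUniformMean.of_tendstoUniformly {s : X → X} {f : X → E} {c : E} {F : ℕ → X → E}
    (hF : TendstoUniformly F (fun _ => c) atTop) (h : ∀ n x, F n x = birkhoffAverage ℝ s f n x) :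
    HasUniformMean s f c := by
  rwa [funext₂ h] at hF

theorem birkhoffAverage_smul_apply {𝕜 : Type*} [NormedField 𝕜] [NormedSpace 𝕜 E]
    [SMulCommClass ℝ 𝕜 E] (s : X → X) (a : 𝕜) (f : X → E) (n : ℕ) (x : X) :
    birkhoffAverage ℝ s (fun y => a • f y) n x = a • birkhoffAverage ℝ s f n x := by
  simp only [birkhoffAverage, birkhoffSum, ← Finset.smul_sum]
  rw [smul_comm]

theorem HasUniformMean.add {s : X → X} {f g : X → E} {c d : E} (hf : HasUniformMean s f c)
    (hg : HasUniformMean s g d) : HasUniformMean s (fun x => f x + g x) (c + d) := by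
  refine HasUniformMean.of_tendstoUniformly (TendstoUniformly.add hf hg) (fun n x => ?_)
  exact (congrFun (congrFun (birkhoffAverage_add (R := ℝ) (f := s) (g := f) (g' := g)) n) x).symm

theorem HasUniformMean.smul {s : X → X} {f : X → ℂ} {c : ℂ} (a : ℂ)
    (hf : HasUniformMean s f c) : HasUniformMean s (fun x => a • f x) (a • c) := by
  refine HasUniformMean.of_tendstoUniformly
    ((uniformContinuous_const_smul a).comp_tendstoUniformly hf)
    (fun n x => ?_)
  exact (birkhoffAverage_smul_apply s a f n x).symm

theorem hasUniformMean_const (s : X → X) (c : E) : HasUniformMean s (fun _ => c) c := by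
  refine Metric.tendstoUniformly_iff.2 fun ε hε => ?_
  filter_upwards [eventually_ne_atTop 0] with n hn x
  have : (n : ℝ) ≠ 0 := by exact_mod_cast hn
  simpa [birkhoffAverage, birkhoffSum, ← Nat.cast_smul_eq_nsmul ℝ, smul_smul, this] using hε

theorem norm_birkhoffAverage_le (s : X → X) {f : X → E} {C : ℝ} (hf : ∀ x, ‖f x‖ ≤ C) (n : ℕ)
    (x : X) : ‖birkhoffAverage ℝ s f n x‖ ≤ C := by
  have hC : 0 ≤ C := (norm_nonneg _).trans (hf x)
  rcases Nat.eq_zero_or_pos n with rfl | hn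
  · simpa using hC
  · have hn' : (0 : ℝ) < n := by exact_mod_cast hn
    rw [birkhoffAverage, norm_smul, norm_inv, Real.norm_natCast, inv_mul_le_iff₀ hn']
    refine (norm_sum_le_of_le _ fun k _ => hf _).trans ?_
    simp

theorem HasUniformMean.of_semiconj {s : X → X} {t : Y → Y} {π : X → Y}
    (hπ : Function.Surjective π) (h : Function.Semiconj π s t) {f : Y → E} {c : E}
    (hf : HasUniformMean s (f ∘ π) c) : HasUniformMean t f c := by
  refine Metric.tendstoUniformly_iff.2 fun ε hε => ?_
  filter_upwards [Metric.tendstoUniformly_iff.1 hf ε hε] with n hn y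
  obtain ⟨x, rfl⟩ := hπ y
  convert! hn x using 2
  simp only [birkhoffAverage, birkhoffSum, Function.comp_apply]
  congr 2 with k
  rw [← (h.iterate_right k).eq x]

/-- A bounded function whose sums over `M` consecutive orbit points are constant has a uniform
mean. -/
theorem hasUniformMean_of_periodic {s : X → X} {f : X → E} {C : ℝ} (hC : ∀ x, ‖f x‖ ≤ C) {M : ℕ}
    (hM : 0 < M) {c : E} (hc : ∀ x, birkhoffSum s f M x = c) :
    HasUniformMean s f ((M : ℝ)⁻¹ • c) := by
  have hM' : (M : ℝ) ≠ 0 := by exact_mod_cast hM.ne'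
  have hmul : ∀ q x, birkhoffSum s f (M * q) x = (q : ℝ) • c := by
    intro q
    induction q with
    | zero => simp
    | succ q ih =>
      intro x
      rw [Nat.mul_succ, birkhoffSum_add, ih, hc]
      push_cast
      rw [add_smul, one_smul]
  -- Full blocks of length M contribute exactly c each, so only the incomplete block of length n % M
  -- causes an error, bounded independently of n and x.
  have key : ∀ n x, ‖birkhoffSum s f n x - (n : ℝ) • (M : ℝ)⁻¹ • c‖ ≤ M * C + ‖c‖ := by
    intro n x
    have h1 : n = M * (n / M) + n % M := (Nat.div_add_mod n M).symm
    have h2 : birkhoffSum s f n x - (n : ℝ) • (M : ℝ)⁻¹ • c =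
        birkhoffSum s f (n % M) (s^[M * (n / M)] x) - ((n % M : ℕ) / M : ℝ) • c := by
      have h3 : (n : ℝ) = M * (n / M : ℕ) + (n % M : ℕ) := by exact_mod_cast h1
      have h4 : (n : ℝ) • (M : ℝ)⁻¹ • c =
          ((n / M : ℕ) : ℝ) • c + ((n % M : ℕ) / M : ℝ) • c := by
        rw [smul_smul, ← add_smul, h3]
        congr 1
        field_simp
      conv_lhs => rw [h4]; rw [h1, birkhoffSum_add, hmul]
      simp only [← h1]
      abel
    rw [h2]
    have hlt := Nat.mod_lt n hM
    refine (norm_sub_le _ _).trans (add_le_add ?_ ?_)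
    · refine (norm_sum_le_of_le _ fun k _ => hC _).trans ?_
      have hC0 : 0 ≤ C := (norm_nonneg _).trans (hC x)
      simp only [Finset.sum_const, Finset.card_range, nsmul_eq_mul]
      gcongr
    · rw [norm_smul]
      refine mul_le_of_le_one_left (norm_nonneg _) ?_
      rw [Real.norm_of_nonneg (by positivity), div_le_one (by positivity)]
      exact_mod_cast hlt.le
  refine Metric.tendstoUniformly_iff.2 fun ε hε => ?_
  have hlim : Tendsto (fun n : ℕ => (M * C + ‖c‖) / (n : ℝ)) atTop (𝓝 0) :=
    tendsto_const_div_atTop_nhds_zero_nat _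
  filter_upwards [hlim.eventually_lt_const hε, eventually_gt_atTop 0] with n hn hn0 x
  have hn' : (0 : ℝ) < n := by exact_mod_cast hn0
  rw [dist_comm, dist_eq_norm]
  refine lt_of_le_of_lt ?_ hn
  have h5 : birkhoffAverage ℝ s f n x - (M : ℝ)⁻¹ • c =
      (n : ℝ)⁻¹ • (birkhoffSum s f n x - (n : ℝ) • (M : ℝ)⁻¹ • c) := by
    rw [smul_sub, inv_smul_smul₀ hn'.ne']
    rfl
  rw [h5, norm_smul, norm_inv, Real.norm_natCast, inv_mul_eq_div]
  gcongr
  exact key n x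

/-- Averaging does not increase the supremum norm, so averages of a limit function are eventually
almost constant and uniformly Cauchy. The mean is then found as the limit at a single point. -/
theorem isClosed_exists_hasUniformMean [TopologicalSpace X] [CompactSpace X] [Nonempty X]
    (s : X → X) : IsClosed {f : C(X, ℂ) | ∃ c, HasUniformMean s f c} := by
  refine isClosed_of_closure_subset fun f hf => ?_
  obtain ⟨x₀⟩ := ‹Nonempty X›
  have hcauchy : UniformCauchySeqOn (fun n x => birkhoffAverage ℝ s f n x) atTop univ ∧
      ∀ ε > 0, ∀ᶠ n in atTop, ∀ x y,
        dist (birkhoffAverage ℝ s f n x) (birkhoffAverage ℝ s f n y) < ε := by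
    have aux : ∀ ε > 0, ∃ N, ∃ c, ∀ n ≥ N, ∀ x, dist (birkhoffAverage ℝ s f n x) c < ε := by
      intro ε hε
      obtain ⟨g, ⟨c, hg⟩, hfg⟩ := Metric.mem_closure_iff.1 hf (ε / 2) (by positivity)
      obtain ⟨N, hN⟩ := eventually_atTop.1 (Metric.tendstoUniformly_iff.1 hg (ε / 2)
        (by positivity))
      refine ⟨N, c, fun n hn x => ?_⟩
      have h1 : dist (birkhoffAverage ℝ s f n x) (birkhoffAverage ℝ s g n x) ≤ dist f g := by
        rw [dist_eq_norm, ← Pi.sub_apply, ← Pi.sub_apply, ← birkhoffAverage_sub]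
        refine norm_birkhoffAverage_le s (fun x => ?_) n x
        rw [Pi.sub_apply, ← dist_eq_norm]
        exact ContinuousMap.dist_apply_le_dist x
      have h2 := hN n hn x
      rw [dist_comm] at h2
      linarith [dist_triangle (birkhoffAverage ℝ s f n x) (birkhoffAverage ℝ s g n x) c]
    constructor
    · refine Metric.uniformCauchySeqOn_iff.2 fun ε hε => ?_
      obtain ⟨N, c, h⟩ := aux (ε / 2) (by positivity)
      refine ⟨N, fun m hm n hn x _ => ?_⟩
      linarith [dist_triangle_right (birkhoffAverage ℝ s f m x) (birkhoffAverage ℝ s f n x) c,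
        h m hm x, h n hn x]
    · intro ε hε
      obtain ⟨N, c, h⟩ := aux (ε / 2) (by positivity)
      refine eventually_atTop.2 ⟨N, fun n hn x y => ?_⟩
      linarith [dist_triangle_right (birkhoffAverage ℝ s f n x) (birkhoffAverage ℝ s f n y) c,
        h n hn x, h n hn y]
  obtain ⟨h1, h2⟩ := hcauchy
  obtain ⟨c, hc⟩ := cauchySeq_tendsto_of_complete (h1.cauchySeq (mem_univ x₀))
  refine ⟨c, Metric.tendstoUniformly_iff.2 fun ε hε => ?_⟩
  filter_upwards [h2 (ε / 2) (by positivity), Metric.tendsto_nhds.1 hc (ε / 2) (by positivity)]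
    with n hn hn' x
  rw [dist_comm]
  linarith [dist_triangle (birkhoffAverage ℝ s f n x) (birkhoffAverage ℝ s f n x₀) c, hn x x₀]

theorem exists_hasUniformMean_of_dense_span [TopologicalSpace X] [CompactSpace X] [Nonempty X]
    {s : X → X} {S : Set C(X, ℂ)} (hS : Dense (Submodule.span ℂ S : Set C(X, ℂ)))
    (h : ∀ f ∈ S, ∃ c, HasUniformMean s f c) (f : C(X, ℂ)) : ∃ c, HasUniformMean s f c := by
  have hsub : (Submodule.span ℂ S : Set C(X, ℂ)) ⊆ {f | ∃ c, HasUniformMean s f c} := by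
    intro f hf
    induction hf using Submodule.span_induction with
    | mem f hf => exact h f hf
    | zero => exact ⟨0, hasUniformMean_const s 0⟩
    | add f g _ _ hf hg =>
      obtain ⟨c, hc⟩ := hf
      obtain ⟨d, hd⟩ := hg
      exact ⟨_, hc.add hd⟩
    | smul a f _ hf =>
      obtain ⟨c, hc⟩ := hf
      exact ⟨_, hc.smul a⟩
  exact closure_minimal hsub (isClosed_exists_hasUniformMean s) (hS f)

end UniformMean

/-! ### From uniform means to unique ergodicity -/

section UniqueErgodicity

variable {X : Type*} [TopologicalSpace X] [CompactSpace X] [MeasurableSpace X] [BorelSpace X]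

theorem IsInvariantMeasure.integral_eq {s : X ≃ₜ X} {μ : Measure X} (hμ : IsInvariantMeasure s μ)
    {f : C(X, ℝ)} {c : ℝ} (hf : HasUniformMean s f c) : ∫ x, f x ∂μ = c := by
  have := hμ.prob
  have hmp : MeasurePreserving s μ μ :=
    ⟨s.continuous.measurable, Measure.ext fun B hB => by
      rw [Measure.map_apply s.continuous.measurable hB, hμ.invariant B hB]⟩
  have hint : ∀ g : X → ℝ, Continuous g → Integrable g μ := fun g hg =>
    hg.integrable_of_hasCompactSupport (HasCompactSupport.of_compactSpace g)
  have hcont : ∀ k, Continuous fun x => f (s^[k] x) := fun k =>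
    f.continuous.comp (s.continuous.iterate k)
  have havg : ∀ n ≠ 0, ∫ x, birkhoffAverage ℝ s f n x ∂μ = ∫ x, f x ∂μ := by
    intro n hn
    have hk : ∀ k, ∫ x, f (s^[k] x) ∂μ = ∫ x, f x ∂μ := fun k =>
      (hmp.iterate k).integral_comp (by
        have : (s^[k] : X → X) = ((s ^ k : X ≃ₜ X) : X → X) := by
          induction k with
          | zero => rfl
          | succ k ih => rw [Function.iterate_succ', ih, pow_succ']; rfl
        rw [this]
        exact (s ^ k).measurableEmbedding) f
    simp only [birkhoffAverage, birkhoffSum, smul_eq_mul]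
    rw [integral_const_mul, integral_finsetSum _ fun k _ => hint _ (hcont k)]
    simp [hk, hn]
  have hlim : Tendsto (fun n : ℕ => ∫ x, birkhoffAverage ℝ s f n x ∂μ) atTop (𝓝 c) := by
    refine Metric.tendsto_nhds.2 fun ε hε => ?_
    filter_upwards [Metric.tendstoUniformly_iff.1 hf (ε / 2) (by positivity)] with n hn
    have hi : Integrable (fun x => birkhoffAverage ℝ s f n x) μ := by
      refine hint _ ?_
      simp only [birkhoffAverage, birkhoffSum]
      exact (continuous_finsetSum _ fun k _ => hcont k).const_smul (n : ℝ)⁻¹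
    have h1 : ∫ x, birkhoffAverage ℝ s f n x ∂μ - c = ∫ x, (birkhoffAverage ℝ s f n x - c) ∂μ := by
      rw [integral_sub hi (integrable_const c)]
      simp
    rw [dist_eq_norm, h1]
    refine (norm_integral_le_of_norm_le_const (C := ε / 2)
      (Eventually.of_forall fun x => ?_)).trans_lt ?_
    · rw [← dist_eq_norm, dist_comm]
      exact (hn x).le
    · simpa using hε
  refine tendsto_nhds_unique (tendsto_const_nhds.congr' ?_) hlim
  filter_upwards [eventually_ne_atTop 0] with n hn
  exact (havg n hn).symm

/-- The mean is a positive normalised functional, so Riesz representation yields a probability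
measure. It is invariant because f and f ∘ s have the same mean, and unique because any invariant
measure integrates f to its mean. -/
theorem uniquelyErgodic_of_hasUniformMean [T2Space X] [Nonempty X] {s : X ≃ₜ X}
    (h : ∀ f : C(X, ℂ), ∃ c, HasUniformMean s f c) : UniquelyErgodic s := by
  have hreal : ∀ f : C(X, ℝ), ∃ c, HasUniformMean s f c := by
    intro f
    obtain ⟨c, hc⟩ := h ⟨fun x => (f x : ℂ), by fun_prop⟩
    refine ⟨c.re, HasUniformMean.of_tendstoUniformly
      (Complex.reCLM.uniformContinuous.comp_tendstoUniformly hc)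
      (fun n x => ?_)⟩
    simp only [Function.comp_apply]
    rw [map_birkhoffAverage ℝ ℝ Complex.reCLM]
    rfl
  choose L hL using hreal
  obtain ⟨x₀⟩ := ‹Nonempty X›
  have huniq : ∀ {f : C(X, ℝ)} {c : ℝ}, HasUniformMean s f c → L f = c := fun {f c} hc =>
    tendsto_nhds_unique ((hL f).tendsto_at x₀) (hc.tendsto_at x₀)
  let Λ : CompactlySupportedContinuousMap X ℝ →ₚ[ℝ] ℝ := PositiveLinearMap.mk₀
    { toFun := fun f => L f
      map_add' := fun f g => huniq ((hL f).add (hL g))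
      map_smul' := fun a f => huniq (by
        refine HasUniformMean.of_tendstoUniformly
          ((uniformContinuous_const_smul a).comp_tendstoUniformly (hL f))
          (fun n x => ?_)
        exact (birkhoffAverage_smul_apply s a f n x).symm) }
    (fun f hf => by
      refine ge_of_tendsto' ((hL f).tendsto_at x₀) fun n => ?_
      exact smul_nonneg (by positivity) (Finset.sum_nonneg fun k _ => hf _))
  let toC : C(X, ℝ) → CompactlySupportedContinuousMap X ℝ :=
    CompactlySupportedContinuousMap.continuousMapEquiv
  have hΛ : ∀ f : C(X, ℝ), ∫ x, f x ∂(RealRMK.rieszMeasure Λ) = L f := fun f =>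
    RealRMK.integral_rieszMeasure Λ (toC f)
  have hprob : IsProbabilityMeasure (RealRMK.rieszMeasure Λ) := by
    have h1 := hΛ (ContinuousMap.const X 1)
    rw [huniq (hasUniformMean_const s (1 : ℝ))] at h1
    simp only [ContinuousMap.const_apply, integral_const, smul_eq_mul, mul_one] at h1
    refine ⟨?_⟩
    rwa [Measure.real, ENNReal.toReal_eq_one_iff] at h1
  have hinv : Measure.map s (RealRMK.rieszMeasure Λ) = RealRMK.rieszMeasure Λ := by
    have : (Measure.map s (RealRMK.rieszMeasure Λ)).Regular := Measure.Regular.map s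
    have : IsProbabilityMeasure (Measure.map s (RealRMK.rieszMeasure Λ)) :=
      Measure.isProbabilityMeasure_map s.continuous.aemeasurable
    refine Measure.ext_of_integral_eq_on_compactlySupported fun f => ?_
    let f' : C(X, ℝ) := f
    refine (integral_map s.continuous.aemeasurable f'.continuous.aestronglyMeasurable).trans ?_
    have h2 : HasUniformMean s (f'.comp ⟨s, s.continuous⟩) (L f') := by
      refine Metric.tendstoUniformly_iff.2 fun ε hε => ?_
      filter_upwards [Metric.tendstoUniformly_iff.1 (hL f') ε hε] with n hn x
      convert! hn (s x) using 2
      simp only [birkhoffAverage, birkhoffSum]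
      congr 2 with k
      exact congrArg f' ((Function.Commute.self_iterate s k).eq x)
    exact (hΛ (f'.comp ⟨s, s.continuous⟩)).trans ((huniq h2).trans (hΛ f').symm)
  refine ⟨RealRMK.rieszMeasure Λ, ⟨hprob, inferInstance, fun B hB => ?_⟩, fun ν hν => ?_⟩
  · rw [← Measure.map_apply s.continuous.measurable hB, hinv]
  · have := hν.prob
    have := hν.regular
    refine Measure.ext_of_integral_eq_on_compactlySupported fun f => ?_
    let f' : C(X, ℝ) := f
    exact (hν.integral_eq (hL f')).trans (hΛ f').symm

end UniqueErgodicity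

/-! ### Multiplicative differences -/

section Ratio

variable {X : Type*}

/-- The multiplicative difference operator `g ↦ (g ∘ t) / g`. -/
noncomputable def ratio (t : X → X) : (X → Circle) →* (X → Circle) where
  toFun g x := g (t x) / g x
  map_one' := by ext; simp
  map_mul' g h := by funext x; simp only [Pi.mul_apply, mul_div_mul_comm]

theorem ratio_apply (t : X → X) (g : X → Circle) (x : X) : ratio t g x = g (t x) / g x := rfl

theorem ratio_eq_one_iff {t : X → X} {g : X → Circle} : ratio t g = 1 ↔ ∀ x, g (t x) = g x := by
  simp [funext_iff, ratio_apply, div_eq_one]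

theorem ratio_const (t : X → X) (c : Circle) : ratio t (fun _ => c) = 1 :=
  ratio_eq_one_iff.2 fun _ => rfl

theorem ratio_commute {t t' : X → X} (h : Function.Commute t t') :
    Function.Commute (ratio t) (ratio t') := fun g => by
  funext x
  simp only [ratio_apply, h.eq x]
  rw [div_div_div_comm]

theorem ratio_comp_commute {t t' : X → X} (h : Function.Commute t t') :
    Function.Commute (ratio t) (fun g => g ∘ t') := fun g => by
  funext x
  simp only [ratio_apply, Function.comp_apply, h.eq x]

theorem ratio_iterate_of_invariant {t : X → X} {v b : X → Circle} (h : ratio t v = b)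
    (hb : ratio t b = 1) (k : ℕ) : ratio (t^[k]) v = b ^ k := by
  rw [ratio_eq_one_iff] at hb
  have hbk : ∀ k x, b (t^[k] x) = b x := by
    intro k
    induction k with
    | zero => exact fun _ => rfl
    | succ k ih => exact fun x => by rw [Function.iterate_succ_apply', hb, ih]
  have hv : ∀ x, v (t x) = b x * v x := fun x => by
    rw [← h, ratio_apply, div_mul_cancel]
  funext x
  rw [ratio_apply, div_eq_iff_eq_mul, Pi.pow_apply]
  induction k with
  | zero => simp
  | succ k ih => rw [Function.iterate_succ_apply', hv, hbk, ih, pow_succ', mul_assoc]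

/-- The analogue of substituting kn for n in a polynomial of degree d, which multiplies the leading
coefficient by k^d. -/
theorem iterate_ratio_iterate {t : X → X} {b : X → Circle} (hb : ratio t b = 1) (k d : ℕ)
    {g : X → Circle} (h : (ratio t)^[d] g = b) : (ratio (t^[k]))^[d] g = b ^ k ^ d := by
  induction d generalizing g b with
  | zero => simpa using h
  | succ d ih =>
    have hc : Function.Commute (ratio t) (ratio (t^[k])) :=
      ratio_commute (Function.Commute.self_iterate t k)
    rw [Function.iterate_succ_apply]
    have h1 : (ratio t)^[d] (ratio (t^[k]) g) = b ^ k := by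
      rw [(hc.iterate_left d).eq g]
      refine ratio_iterate_of_invariant ?_ hb k
      rwa [← Function.iterate_succ_apply' (ratio t)]
    rw [ih (by rw [map_pow, hb, one_pow]) h1, ← pow_mul, pow_succ']

/-- The values along an orbit turn difference operators of a map into those of a shift of `ℕ`. -/
theorem iterate_ratio_orbit (s : X → X) (M d : ℕ) (g : X → Circle) (x : X) :
    (ratio (· + M))^[d] (fun n => g (s^[n] x)) = fun n => (ratio (s^[M]))^[d] g (s^[n] x) := by
  induction d with
  | zero => rfl
  | succ d ih =>
    rw [Function.iterate_succ_apply', Function.iterate_succ_apply', ih]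
    funext n
    simp only [ratio_apply]
    rw [add_comm n M, Function.iterate_add_apply]

end Ratio

/-! ### Van der Corput's inequality and Weyl's theorem -/

section Weyl

theorem norm_sum_shift_sub_le {u : ℕ → ℂ} (hu : ∀ i, ‖u i‖ ≤ 1) (n m : ℕ) :
    ‖∑ i ∈ Finset.range n, u (i + m) - ∑ i ∈ Finset.range n, u i‖ ≤ 2 * m := by
  have h1 := Finset.sum_range_add u n m
  have h2 := Finset.sum_range_add u m n
  rw [add_comm m n] at h2
  have h3 : ∑ i ∈ Finset.range n, u (i + m) - ∑ i ∈ Finset.range n, u i =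
      ∑ i ∈ Finset.range m, u (n + i) - ∑ i ∈ Finset.range m, u i := by
    simp only [add_comm _ m]
    linear_combination h1 - h2
  have h4 : ∀ v : ℕ → ℂ, (∀ i, ‖v i‖ ≤ 1) → ‖∑ i ∈ Finset.range m, v i‖ ≤ m := fun v hv =>
    (norm_sum_le_of_le _ fun i _ => hv i).trans (by simp)
  rw [h3, two_mul]
  exact (norm_sub_le _ _).trans (add_le_add (h4 _ fun i => hu _) (h4 _ hu))

/-- The van der Corput inequality. -/
theorem van_der_corput (u : ℕ → Circle) {M K n : ℕ} (hK : 0 < K) {ε δ : ℝ} (hδ : 0 ≤ δ)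
    (hε : 0 ≤ ε) (hεδ : (K : ℝ)⁻¹ + ε ≤ δ ^ 2)
    (h : ∀ k < K, ∀ l < k,
      ‖∑ i ∈ Finset.range n, ((u (i + k * M) / u (i + l * M) : Circle) : ℂ)‖ ≤ ε * n) :
    ‖∑ i ∈ Finset.range n, (u i : ℂ)‖ ≤ 2 * (K * M) + δ * n := by
  have hK' : (0 : ℝ) < K := by exact_mod_cast hK
  set S := ∑ i ∈ Finset.range n, (u i : ℂ) with hS
  -- Averaging over K shifts replaces u by the window sums V at the cost of boundary terms;
  -- Cauchy–Schwarz then reduces the estimate to correlations between shifts.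
  let V : ℕ → ℂ := fun i => ∑ k ∈ Finset.range K, (u (i + k * M) : ℂ)
  have hVS : ‖∑ i ∈ Finset.range n, V i - K * S‖ ≤ K * (2 * (K * M)) := by
    have h1 : ∑ i ∈ Finset.range n, V i - K * S = ∑ k ∈ Finset.range K,
        (∑ i ∈ Finset.range n, (u (i + k * M) : ℂ) - S) := by
      rw [Finset.sum_comm, Finset.sum_sub_distrib]
      simp
    rw [h1]
    refine (norm_sum_le_of_le (f := fun k => ∑ i ∈ Finset.range n, (u (i + k * M) : ℂ) - S)
      (n := fun _ => 2 * ((K : ℝ) * M)) _ fun k hk => ?_).trans (by simp)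
    refine (norm_sum_shift_sub_le (u := fun i => (u i : ℂ)) (fun i => (Circle.norm_coe (u i)).le) n (k * M)).trans ?_
    push_cast
    have : (k : ℝ) ≤ K := by exact_mod_cast (Finset.mem_range.1 hk).le
    gcongr
  have hpair : ∀ k ∈ Finset.range K, ∀ l ∈ Finset.range K,
      ‖∑ i ∈ Finset.range n, (u (i + k * M) : ℂ) * (starRingEnd ℂ) (u (i + l * M) : ℂ)‖ ≤
        (if k = l then (n : ℝ) else 0) + ε * n := by
    intro k hk l hl
    rw [Finset.mem_range] at hk hl
    have hn : (0 : ℝ) ≤ ε * n := by positivity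
    rcases lt_trichotomy k l with hkl | rfl | hkl
    · rw [if_neg hkl.ne, zero_add, ← Complex.norm_conj, map_sum]
      convert h l hl k hkl using 3 with i
      rw [map_mul, Complex.conj_conj, div_eq_mul_inv, Circle.coe_mul, Circle.coe_inv_eq_conj,
        mul_comm]
    · rw [if_pos rfl]
      refine le_add_of_le_of_nonneg ((norm_sum_le_of_le _ fun i _ => ?_).trans
        (by simp : ∑ i ∈ Finset.range n, (1 : ℝ) ≤ n)) hn
      rw [norm_mul, Complex.norm_conj, Circle.norm_coe, one_mul]
    · rw [if_neg hkl.ne', zero_add]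
      convert h k hk l hkl using 3 with i
      rw [div_eq_mul_inv, Circle.coe_mul, Circle.coe_inv_eq_conj]
  -- The K diagonal pairs give n each and every pair adds at most ε n, for a total of K²(1/K + ε)n.
  have hsq : ∑ i ∈ Finset.range n, ‖V i‖ ^ 2 ≤ (K * δ) ^ 2 * n := by
    have h1 : ((∑ i ∈ Finset.range n, ‖V i‖ ^ 2 : ℝ) : ℂ) =
        ∑ k ∈ Finset.range K, ∑ l ∈ Finset.range K, ∑ i ∈ Finset.range n,
          (u (i + k * M) : ℂ) * (starRingEnd ℂ) (u (i + l * M) : ℂ) := by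
      push_cast
      simp_rw [← Complex.mul_conj', V, map_sum, Finset.sum_mul_sum]
      rw [Finset.sum_comm]
      refine Finset.sum_congr rfl fun k _ => Finset.sum_comm
    have h2 : ∑ i ∈ Finset.range n, ‖V i‖ ^ 2 =
        ‖((∑ i ∈ Finset.range n, ‖V i‖ ^ 2 : ℝ) : ℂ)‖ := by
      rw [Complex.norm_of_nonneg (by positivity)]
    rw [h2, h1]
    refine (norm_sum_le_of_le _ fun k hk => norm_sum_le_of_le _ fun l hl =>
      hpair k hk l hl).trans ?_
    have h3 : ∑ k ∈ Finset.range K, ∑ l ∈ Finset.range K,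
        ((if k = l then (n : ℝ) else 0) + ε * n) = K * n + K * (K * (ε * n)) := by
      simp only [Finset.sum_add_distrib, Finset.sum_ite_eq, Finset.sum_const, Finset.card_range,
        nsmul_eq_mul]
      congr 1
      rw [Finset.sum_congr rfl fun k hk => if_pos hk]
      simp
    rw [h3]
    have h4 : (K : ℝ) * n + K * (K * (ε * n)) = K ^ 2 * ((K : ℝ)⁻¹ + ε) * n := by
      field_simp
    rw [h4, mul_pow]
    gcongr
  have hV : ‖∑ i ∈ Finset.range n, V i‖ ≤ K * δ * n := by
    refine (norm_sum_le _ _).trans (le_of_sq_le_sq ?_ (by positivity))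
    refine (sq_sum_le_card_mul_sum_sq (s := Finset.range n) (f := fun i => ‖V i‖)).trans ?_
    rw [Finset.card_range]
    calc (n : ℝ) * ∑ i ∈ Finset.range n, ‖V i‖ ^ 2 ≤ n * ((K * δ) ^ 2 * n) := by gcongr
      _ = (K * δ * n) ^ 2 := by ring
  have hfin : K * ‖S‖ ≤ K * (2 * (K * M) + δ * n) := by
    have h1 : (K : ℝ) * ‖S‖ = ‖(K : ℂ) * S‖ := by simp
    have h2 := norm_sub_norm_le ((K : ℂ) * S) (∑ i ∈ Finset.range n, V i)
    rw [norm_sub_rev] at h2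
    rw [h1]
    linarith
  exact le_of_mul_le_mul_left hfin hK'

/-- Weyl's theorem: the averages of a sequence of unimodular numbers tend to zero when an iterated
difference is a constant of infinite order, uniformly in the sequence. -/
theorem eventually_norm_sum_le (M d : ℕ) {a : Circle} (ha : ¬IsOfFinOrder a) {ε : ℝ}
    (hε : 0 < ε) : ∀ᶠ n : ℕ in atTop, ∀ u : ℕ → Circle,
      (ratio (· + M))^[d + 1] u = (fun _ => a) →
        ‖∑ i ∈ Finset.range n, (u i : ℂ)‖ ≤ ε * n := by
  induction d generalizing a ε with
  | zero =>
    have ha1 : (a : ℂ) - 1 ≠ 0 := by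
      rw [sub_ne_zero]
      intro h
      exact ha ((Circle.coe_eq_one.1 h) ▸ IsOfFinOrder.one)
    have hlim : Tendsto (fun n : ℕ => ε * (n : ℝ)) atTop atTop :=
      tendsto_natCast_atTop_atTop.const_mul_atTop hε
    filter_upwards [hlim.eventually_ge_atTop (2 * M / ‖(a : ℂ) - 1‖)] with n hn u hu
    refine le_trans ?_ hn
    rw [le_div_iff₀ (norm_pos_iff.2 ha1), mul_comm, ← norm_mul, sub_mul, one_mul]
    have h1 : ∀ i, (a : ℂ) * u i = u (i + M) := fun i => by
      rw [← Circle.coe_mul, ← congrFun hu i]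
      simp [ratio_apply]
    rw [Finset.mul_sum]
    simp only [h1]
    exact norm_sum_shift_sub_le (u := fun i => (u i : ℂ)) (fun i => (Circle.norm_coe (u i)).le) n M
  | succ d ih =>
    set δ := ε / 2 with hδ
    have hδ0 : 0 < δ := by positivity
    obtain ⟨K, hK0, hK⟩ : ∃ K : ℕ, 0 < K ∧ (K : ℝ)⁻¹ ≤ δ ^ 2 / 2 := by
      obtain ⟨K, hK⟩ := exists_nat_one_div_lt (show 0 < δ ^ 2 / 2 by positivity)
      refine ⟨K + 1, K.succ_pos, ?_⟩
      rw [one_div] at hK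
      exact_mod_cast hK.le
    have hlim : Tendsto (fun n : ℕ => δ * (n : ℝ)) atTop atTop :=
      tendsto_natCast_atTop_atTop.const_mul_atTop hδ0
    -- The correlation of shifts kM and lM is a difference of u with step (k - l)M, so its (d+1)-st
    -- difference is a^(k-l), again of infinite order. Finitely many exponents occur, so one
    -- threshold for n serves all.
    have hall : ∀ᶠ n : ℕ in atTop, ∀ k ∈ Finset.Ioo 0 K, ∀ u : ℕ → Circle,
        (ratio (· + M))^[d + 1] u = (fun _ => a ^ k) →
          ‖∑ i ∈ Finset.range n, (u i : ℂ)‖ ≤ δ ^ 2 / 2 * n := by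
      refine (Filter.eventually_all_finset _).2 fun k hk => ih ?_ (by positivity)
      rw [isOfFinOrder_pow]
      exact fun h => h.elim ha (Finset.mem_Ioo.1 hk).1.ne'
    filter_upwards [hall, hlim.eventually_ge_atTop (2 * (K * M))] with n hn hn' u hu
    refine (van_der_corput u (M := M) hK0 hδ0.le (by positivity : 0 ≤ δ ^ 2 / 2) (by linarith)
      fun k hk l hlk => ?_).trans (by rw [show ε = δ + δ by ring]; linarith)
    have hit : ∀ k, (· + M)^[k] = (· + k * M : ℕ → ℕ) := fun k => by
      rw [add_right_iterate]; rfl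
    refine hn (k - l) (Finset.mem_Ioo.2 ⟨by omega, by omega⟩)
      (fun i => u (i + k * M) / u (i + l * M)) ?_
    have h1 : (fun i => u (i + k * M) / u (i + l * M)) =
        ratio ((· + M)^[k - l]) (u ∘ (· + M)^[l]) := by
      funext i
      simp only [ratio_apply, hit, Function.comp_apply]
      rw [add_assoc, ← add_mul, Nat.sub_add_cancel hlk.le]
    have h2 : (ratio (· + M))^[d + 1 + 1] (u ∘ (· + M)^[l]) = fun _ => a := by
      rw [((ratio_comp_commute (Function.Commute.self_iterate (· + M) l)).iterate_left _).eq u, hu]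
      rfl
    rw [h1, ((ratio_commute (Function.Commute.self_iterate (· + M) (k - l))).iterate_left _).eq]
    refine ratio_iterate_of_invariant (b := fun _ => a) ?_ (ratio_const _ _) _
    rwa [← Function.iterate_succ_apply' (ratio _)]

end Weyl

/-! ### The dichotomy for groups of quasi-eigenfunctions -/

section QuasiEigenfunctionGroup

variable {X : Type*}

theorem hasUniformMean_zero_of_ratio {s : X → X} {M d : ℕ} {g : X → Circle} {a : Circle}
    (ha : ¬IsOfFinOrder a) (h : (ratio (s^[M]))^[d + 1] g = fun _ => a) :
    HasUniformMean s (fun x => (g x : ℂ)) 0 := by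
  refine Metric.tendstoUniformly_iff.2 fun ε hε => ?_
  filter_upwards [eventually_norm_sum_le M d ha (half_pos hε), eventually_gt_atTop 0]
    with n hn hn0 x
  have hn' : (0 : ℝ) < n := by exact_mod_cast hn0
  have h1 := hn (fun n => g (s^[n] x)) (by rw [iterate_ratio_orbit, h])
  rw [dist_zero_left, birkhoffAverage, norm_smul, norm_inv, Real.norm_natCast,
    inv_mul_lt_iff₀ hn']
  refine lt_of_le_of_lt h1 ?_
  rw [mul_comm]
  gcongr
  linarith

theorem iterate_ratio_eq_const_of_le {s : X → X} {g : X → Circle} {k j : ℕ} (hkj : k ≤ j)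
    {c : Circle} (h : (ratio s)^[k] g = fun _ => c) : ∃ c, (ratio s)^[j] g = fun _ => c := by
  induction j, hkj using Nat.le_induction with
  | base => exact ⟨c, h⟩
  | succ j _ ih =>
    obtain ⟨c', hc'⟩ := ih
    exact ⟨1, by rw [Function.iterate_succ_apply', hc', ratio_const]; rfl⟩

variable {s : X → X} {Γ : Subgroup (X → Circle)}

theorem ratio_mem (hΓ : ∀ g ∈ Γ, g ∘ s ∈ Γ) {g : X → Circle} (hg : g ∈ Γ) : ratio s g ∈ Γ :=
  Γ.div_mem (hΓ g hg) hg

theorem iterate_ratio_mem (hΓ : ∀ g ∈ Γ, g ∘ s ∈ Γ) (M d : ℕ) {g : X → Circle} (hg : g ∈ Γ) :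
    (ratio (s^[M]))^[d] g ∈ Γ := by
  have h1 : ∀ M, ∀ g ∈ Γ, g ∘ s^[M] ∈ Γ := by
    intro M
    induction M with
    | zero => exact fun g hg => hg
    | succ M ih => exact fun g hg => hΓ _ (ih g hg)
  induction d with
  | zero => exact hg
  | succ d ih =>
    rw [Function.iterate_succ_apply']
    exact ratio_mem (h1 M) ih

/-- By induction some power h^m has constant ratio b. Going M steps round the period gives b^M = 1,
so h^(mM) is s-invariant, hence constant by `hinv`. -/
theorem exists_pow_eq_const [Nonempty X] (hΓ : ∀ g ∈ Γ, g ∘ s ∈ Γ)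
    (hinv : ∀ g ∈ Γ, ratio s g = 1 → ∃ c, g = fun _ => c) {M : ℕ} (hM : 0 < M) (k : ℕ)
    {h : X → Circle} (hh : h ∈ Γ) (hp : ratio (s^[M]) h = 1) {c : Circle}
    (hk : (ratio s)^[k] h = fun _ => c) : ∃ m > 0, ∃ c, h ^ m = fun _ => c := by
  induction k generalizing h with
  | zero => exact ⟨1, one_pos, c, by simpa using hk⟩
  | succ k ih =>
    obtain ⟨m, hm, b, hb⟩ := ih (ratio_mem hΓ hh)
      (by rw [← (ratio_commute (Function.Commute.self_iterate s M)).eq, hp, map_one]) hk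
    have h1 : ratio s (h ^ m) = fun _ => b := by rw [map_pow, hb]
    have h2 : (fun _ => b : X → Circle) ^ M = 1 := by
      rw [← ratio_iterate_of_invariant h1 (ratio_const s b), map_pow, hp, one_pow]
    obtain ⟨b', hb'⟩ := hinv ((h ^ m) ^ M) (Γ.pow_mem (Γ.pow_mem hh m) M)
      (by rw [map_pow, h1, h2])
    exact ⟨m * M, Nat.mul_pos hm hM, b', by rw [pow_mul, hb']⟩

/-- Descent on d: if the top difference is a root of unity, passing to a multiple of M kills it, and
a further multiple makes the next lower difference constant. -/
theorem ratio_eq_const_or_periodic [Nonempty X] (hΓ : ∀ g ∈ Γ, g ∘ s ∈ Γ)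
    (hq : ∀ g ∈ Γ, ∃ k c, (ratio s)^[k] g = fun _ => c)
    (hinv : ∀ g ∈ Γ, ratio s g = 1 → ∃ c, g = fun _ => c) (d : ℕ) {M : ℕ} (hM : 0 < M)
    {g : X → Circle} (hg : g ∈ Γ) {c : Circle} (h : (ratio (s^[M]))^[d] g = fun _ => c) :
    (∃ M d a, ¬IsOfFinOrder a ∧ (ratio (s^[M]))^[d + 1] g = fun _ => a) ∨
      ∃ M > 0, ratio (s^[M]) g = 1 := by
  induction d generalizing M c with
  | zero => exact Or.inr ⟨M, hM, by rw [show g = fun _ => c from h, ratio_const]⟩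
  | succ d ih =>
    by_cases hc : IsOfFinOrder c
    · set k := orderOf c with hk
      have hMk : 0 < M * k := Nat.mul_pos hM hc.orderOf_pos
      have h1 : (ratio (s^[M * k]))^[d + 1] g = 1 := by
        rw [Function.iterate_mul, iterate_ratio_iterate (ratio_const _ c) k (d + 1) h, pow_succ',
          pow_mul]
        funext x
        simp [hk, pow_orderOf_eq_one]
      rcases Nat.eq_zero_or_pos d with rfl | hd
      · exact Or.inr ⟨M * k, hMk, h1⟩
      · set b := (ratio (s^[M * k]))^[d] g with hb
        have hbΓ : b ∈ Γ := iterate_ratio_mem hΓ _ _ hg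
        have hb1 : ratio (s^[M * k]) b = 1 := by rwa [Function.iterate_succ_apply'] at h1
        obtain ⟨j, c', hj⟩ := hq b hbΓ
        obtain ⟨m, hm, c'', hm'⟩ := exists_pow_eq_const hΓ hinv hMk j hbΓ hb1 hj
        have h2 := iterate_ratio_iterate hb1 m d hb.symm
        rw [← Function.iterate_mul] at h2
        refine ih (c := c'' ^ m ^ (d - 1)) (Nat.mul_pos hMk hm) (h2.trans ?_)
        rw [← Nat.sub_add_cancel hd, pow_succ', pow_mul, hm', Nat.add_sub_cancel]
        rfl
    · exact Or.inl ⟨M, d, c, hc, h⟩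

/-- In a group of quasi-eigenfunctions, all functions have uniform means as soon as the periodic
ones do. -/
theorem exists_hasUniformMean_of_subgroup [Nonempty X] (hΓ : ∀ g ∈ Γ, g ∘ s ∈ Γ)
    (hq : ∀ g ∈ Γ, ∃ k c, (ratio s)^[k] g = fun _ => c)
    (hper : ∀ g ∈ Γ, ∀ M > 0, ratio (s^[M]) g = 1 → ∃ c, HasUniformMean s (fun x => (g x : ℂ)) c)
    {g : X → Circle} (hg : g ∈ Γ) : ∃ c, HasUniformMean s (fun x => (g x : ℂ)) c := by
  have hinv : ∀ g ∈ Γ, ratio s g = 1 → ∃ c, g = fun _ => c := by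
    -- The averages of an invariant function are the function itself, so having a uniform mean
    -- forces it to be constant.
    intro g hg h
    obtain ⟨c, hc⟩ := hper g hg 1 one_pos h
    have h1 : ∀ x, (g x : ℂ) = c := by
      intro x
      refine tendsto_nhds_unique (tendsto_const_nhds.congr' ?_) (hc.tendsto_at x)
      filter_upwards [eventually_ne_atTop 0] with n hn
      rw [birkhoffAverage_of_comp_eq ℝ (funext fun x => by
        rw [Function.comp_apply, ratio_eq_one_iff.1 h x]) (by exact_mod_cast hn)]
    obtain ⟨x₀⟩ := ‹Nonempty X›
    exact ⟨g x₀, funext fun x => Circle.coe_injective ((h1 x).trans (h1 x₀).symm)⟩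
  obtain ⟨k, c, hk⟩ := hq g hg
  obtain ⟨M, d, a, ha, h⟩ | ⟨M, hM, h⟩ :=
    ratio_eq_const_or_periodic hΓ hq hinv k (M := 1) one_pos hg hk
  · exact ⟨0, hasUniformMean_zero_of_ratio ha h⟩
  · exact hper g hg M hM h

end QuasiEigenfunctionGroup

/-! ### Minimal systems with quasi-discrete spectrum -/

section Minimal

variable {X : Type*} [TopologicalSpace X]

/-- The level sets of F are closed and invariant. -/
theorem IsMinimalSystem.apply_eq {s : X ≃ₜ X} (hs : IsMinimalSystem s) {Z : Type*}
    [TopologicalSpace Z] [T1Space Z] {F : X → Z} (hF : Continuous F) (h : ∀ x, F (s x) = F x)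
    (x y : X) : F x = F y := by
  have hA : s '' (F ⁻¹' {F y}) = F ⁻¹' {F y} := by
    ext z
    constructor
    · rintro ⟨w, hw, rfl⟩
      exact (h w).trans hw
    · intro hz
      refine ⟨s.symm z, ?_, s.apply_symm_apply z⟩
      have := h (s.symm z)
      rw [s.apply_symm_apply] at this
      exact this.symm.trans hz
  have := hs _ (isClosed_singleton.preimage hF) ⟨y, rfl⟩ hA
  exact (this ▸ mem_univ x : x ∈ F ⁻¹' {F y})

/-- The group of all quasi-eigenfunctions. -/
def quasiEigenfunctionGroup (s : X → X) : Subgroup (X → Circle) where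
  carrier := {g | Continuous g ∧ ∃ k c, (ratio s)^[k] g = fun _ => c}
  one_mem' := ⟨continuous_const, 0, 1, rfl⟩
  mul_mem' := by
    rintro g h ⟨hg, k, c, hk⟩ ⟨hh, l, c', hl⟩
    obtain ⟨a, ha⟩ := iterate_ratio_eq_const_of_le (le_max_left k l) hk
    obtain ⟨b, hb⟩ := iterate_ratio_eq_const_of_le (le_max_right k l) hl
    exact ⟨hg.mul hh, max k l, a * b, by rw [iterate_map_mul, ha, hb]; rfl⟩
  inv_mem' := by
    rintro g ⟨hg, k, c, hk⟩
    exact ⟨hg.inv, k, c⁻¹, by rw [iterate_map_inv, hk]; rfl⟩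

theorem mem_quasiEigenfunctionGroup {s : X ≃ₜ X} {m : ℕ} {g : C(X, Circle)}
    (hg : g ∈ quasiEigenfunctions s m) : ⇑g ∈ quasiEigenfunctionGroup s := by
  refine ⟨g.continuous, m, ?_⟩
  induction m generalizing g with
  | zero =>
    obtain ⟨c, hc⟩ := hg
    exact ⟨c, funext hc⟩
  | succ m ih =>
    obtain ⟨f, hf, h⟩ := hg
    obtain ⟨c, hc⟩ := ih hf
    refine ⟨c, ?_⟩
    rw [Function.iterate_succ_apply, ← hc]
    congr 1
    funext x
    rw [ratio_apply, h, mul_div_cancel_right]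

theorem IsMinimalSystem.uniquelyErgodic [CompactSpace X] [T2Space X] [Nonempty X]
    [MeasurableSpace X] [BorelSpace X] {s : X ≃ₜ X} (hs : IsMinimalSystem s)
    (hd : HasQuasiDiscreteSpectrum s) : UniquelyErgodic s := by
  refine uniquelyErgodic_of_hasUniformMean (exists_hasUniformMean_of_dense_span hd ?_)
  rintro f ⟨m, g, hg, hfg⟩
  rw [show (f : X → ℂ) = fun x => (g x : ℂ) from funext hfg]
  refine exists_hasUniformMean_of_subgroup (Γ := quasiEigenfunctionGroup s) ?_
    (fun g hg => hg.2) ?_ (mem_quasiEigenfunctionGroup hg)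
  · rintro g ⟨hg, k, c, hk⟩
    refine ⟨hg.comp s.continuous, k, c, ?_⟩
    rw [((ratio_comp_commute (Function.Commute.refl (s : X → X))).iterate_left k).eq g, hk]
    rfl
  · rintro g ⟨hg, -⟩ M hM hp
    rw [ratio_eq_one_iff] at hp
    obtain ⟨x₀⟩ := ‹Nonempty X›
    refine ⟨_, hasUniformMean_of_periodic (C := 1) (fun x => (Circle.norm_coe (g x)).le) hM
      (c := birkhoffSum s (fun x => (g x : ℂ)) M x₀) fun x => ?_⟩
    refine hs.apply_eq (F := birkhoffSum s (fun x => (g x : ℂ)) M) ?_ (fun x => ?_) x x₀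
    · exact continuous_finsetSum _ fun k _ =>
        continuous_subtype_val.comp (hg.comp (s.continuous.iterate k))
    · rw [← sub_eq_zero, birkhoffSum_apply_sub_birkhoffSum, hp, sub_self]

end Minimal

/-! ### The system (𝓗, T) and its factors -/

section Weyl

theorem exists_circle_pow_eq (x : Circle) {n : ℕ} (hn : 0 < n) : ∃ y : Circle, y ^ n = x := by
  refine ⟨Circle.exp (Complex.arg x / n), ?_⟩
  have : (n : ℝ) ≠ 0 := by exact_mod_cast hn.ne'
  rw [← Circle.exp_nsmul, nsmul_eq_mul, mul_div_cancel₀ _ this, Circle.exp_arg]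

theorem exists_circleQ_generator {N : ℕ} (hN : 0 < N) :
    ∃ z ∈ circleQ, z ^ N = 1 ∧ ∀ y : Circle, y ^ N = 1 → ∃ c : ℤ, y = z ^ c := by
  have : NeZero N := ⟨hN.ne'⟩
  let z : Circle := Circle.exp (2 * Real.pi * ((1 / N : ℚ) : ℝ))
  have hz : IsPrimitiveRoot (z : ℂ) N := by
    convert Complex.isPrimitiveRoot_exp N hN.ne' using 1
    simp only [z, Circle.coe_exp]
    congr 1
    push_cast
    ring
  refine ⟨z, ⟨1 / N, rfl⟩, Circle.coe_injective (by simpa using hz.pow_eq_one), fun y hy => ?_⟩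
  obtain ⟨i, -, hi⟩ := hz.eq_pow_of_pow_eq_one (ξ := (y : ℂ))
    (by rw [← Circle.coe_pow, hy, Circle.coe_one])
  exact ⟨i, Circle.coe_injective (by rw [← hi, zpow_natCast, Circle.coe_pow])⟩

theorem exists_common_circleQ_root (d : ℕ) {x : ℕ → Circle} (hx : ∀ k < d, IsOfFinOrder (x k))
    {n : ℕ → ℕ} (hn : ∀ k, 0 < n k) : ∃ N > 0, ∃ z ∈ circleQ, z ^ N = 1 ∧
      ∃ c : ℕ → ℤ, ∀ k < d, x k = (z ^ n k) ^ c k := by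
  choose y hy using fun k => exists_circle_pow_eq (x k) (hn k)
  -- All the chosen roots y_k of x_k, k < d, are N-th roots of unity, so they are powers of one
  -- generator z.
  let N := ∏ k ∈ Finset.range d, (n k * orderOf (x k))
  have hN : 0 < N := Finset.prod_pos fun k hk =>
    Nat.mul_pos (hn k) (hx k (Finset.mem_range.1 hk)).orderOf_pos
  obtain ⟨z, hz, hzN, h⟩ := exists_circleQ_generator hN
  have hyz : ∀ k, ∃ c : ℤ, k < d → y k = z ^ c := by
    intro k
    by_cases hk : k < d
    · obtain ⟨q, hq⟩ : n k * orderOf (x k) ∣ N :=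
        Finset.dvd_prod_of_mem (fun k => n k * orderOf (x k)) (Finset.mem_range.2 hk)
      obtain ⟨c, hc⟩ := h (y k) (by
        rw [hq, pow_mul, pow_mul, hy, pow_orderOf_eq_one, one_pow])
      exact ⟨c, fun _ => hc⟩
    · exact ⟨0, fun h => absurd h hk⟩
  choose c hc using hyz
  refine ⟨N, hN, z, hz, hzN, c, fun k hk => ?_⟩
  rw [← hy k, hc k hk]
  group

theorem weylHomeo_succ (φ : weylSet) (k : ℕ) :
    (weylHomeo φ).1 (k + 1) = φ.1 k * φ.1 (k + 1) := rfl

theorem weylSet_zero_apply (φ : weylSet) (x : Circle) : φ.1 0 x = x := by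
  rw [φ.2.1]
  rfl

theorem iterate_weylHomeo_one_apply (φ : weylSet) (n : ℕ) (x : Circle) :
    (weylHomeo^[n] φ).1 1 x = x ^ n * φ.1 1 x := by
  induction n with
  | zero => simp
  | succ n ih =>
    rw [Function.iterate_succ_apply', show (1 : ℕ) = 0 + 1 from rfl, weylHomeo_succ,
      MonoidHom.mul_apply, weylSet_zero_apply, zero_add, ih, pow_succ', mul_assoc]

instance instNonemptyWeylSet : Nonempty weylSet := by
  refine ⟨fun k => if k = 0 then MonoidHom.id Circle else 1, rfl, fun k hk x _ => ?_⟩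
  simp only [if_neg (show k ≠ 0 by omega), MonoidHom.one_apply]
  refine (Finset.prod_eq_one fun j hj => ?_).symm
  obtain ⟨i, rfl⟩ := Nat.exists_eq_add_of_le' (Finset.mem_Icc.1 hj).1
  rw [Function.iterate_succ_apply']
  rfl

/-- The function `φ ↦ φ₀(x₀) ⋯ φ_{d-1}(x_{d-1})` on `𝓗`. -/
noncomputable def weylChar (d : ℕ) (x : ℕ → Circle) (φ : weylSet) : Circle :=
  ∏ k ∈ Finset.range d, φ.1 k (x k)

theorem weylChar_succ_apply (d : ℕ) (x : ℕ → Circle) (φ : weylSet) :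
    weylChar (d + 1) x φ = x 0 * ∏ k ∈ Finset.range d, φ.1 (k + 1) (x (k + 1)) := by
  rw [weylChar, Finset.prod_range_succ', weylSet_zero_apply, mul_comm]

theorem continuous_weylChar (d : ℕ) (x : ℕ → Circle) : Continuous (weylChar d x) :=
  continuous_finsetProd _ fun k _ =>
    (continuous_eval (x k)).comp ((continuous_apply k).comp continuous_subtype_val)

theorem weylChar_zero (x : ℕ → Circle) : weylChar 0 x = 1 := rfl

/-- T multiplies φ_{k+1} by φ_k and fixes φ₀, so a difference shifts the arguments and lowers the
length. -/
theorem ratio_weylChar (d : ℕ) (x : ℕ → Circle) :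
    ratio weylHomeo (weylChar (d + 1) x) = weylChar d fun k => x (k + 1) := by
  funext φ
  rw [ratio_apply, weylChar_succ_apply, weylChar_succ_apply, mul_div_mul_left_eq_div,
    ← Finset.prod_div_distrib]
  exact Finset.prod_congr rfl fun k _ => by
    rw [weylHomeo_succ, MonoidHom.mul_apply, mul_div_cancel_right]

theorem iterate_ratio_weylChar (d : ℕ) (x : ℕ → Circle) :
    (ratio weylHomeo)^[d] (weylChar d x) = 1 := by
  induction d generalizing x with
  | zero => rfl
  | succ d ih => rw [Function.iterate_succ_apply, ratio_weylChar, ih]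

theorem weylChar_of_le {d e : ℕ} (h : d ≤ e) (x : ℕ → Circle) :
    weylChar e (fun k => if k < d then x k else 1) = weylChar d x := by
  funext φ
  rw [weylChar, weylChar, ← Finset.prod_subset (Finset.range_mono h)]
  · exact Finset.prod_congr rfl fun k hk => by rw [if_pos (Finset.mem_range.1 hk)]
  · intro k _ hk
    rw [if_neg (by simpa using hk), map_one]

theorem weylChar_mulSingle {k d : ℕ} (hk : k < d) (x : Circle) (φ : weylSet) :
    weylChar d (Pi.mulSingle k x) φ = φ.1 k x := by
  rw [weylChar, Finset.prod_eq_single k]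
  · simp
  · intro j _ hj
    rw [Pi.mulSingle_eq_of_ne hj, map_one]
  · exact fun h => absurd (Finset.mem_range.2 hk) h

theorem weylChar_mul (d : ℕ) (x y : ℕ → Circle) :
    weylChar d (x * y) = weylChar d x * weylChar d y := by
  funext φ
  simp [weylChar, Finset.prod_mul_distrib]

theorem weylChar_inv (d : ℕ) (x : ℕ → Circle) : weylChar d x⁻¹ = (weylChar d x)⁻¹ := by
  funext φ
  simp [weylChar]

/-- The group of all functions `weylChar d x`. -/
def weylCharGroup : Subgroup (weylSet → Circle) where
  carrier := {g | ∃ d x, g = weylChar d x}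
  one_mem' := ⟨0, 1, rfl⟩
  mul_mem' := by
    rintro _ _ ⟨d, x, rfl⟩ ⟨e, y, rfl⟩
    rw [← weylChar_of_le (le_max_left d e) x, ← weylChar_of_le (le_max_right d e) y,
      ← weylChar_mul]
    exact ⟨_, _, rfl⟩
  inv_mem' := by
    rintro _ ⟨d, x, rfl⟩
    exact ⟨d, x⁻¹, (weylChar_inv d x).symm⟩

theorem weylChar_mem (d : ℕ) (x : ℕ → Circle) : weylChar d x ∈ weylCharGroup := ⟨d, x, rfl⟩

theorem comp_weylHomeo_mem {g : weylSet → Circle} (hg : g ∈ weylCharGroup) :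
    g ∘ weylHomeo ∈ weylCharGroup := by
  have h : g ∘ weylHomeo = ratio weylHomeo g * g := by
    funext φ
    rw [Pi.mul_apply, ratio_apply, div_mul_cancel, Function.comp_apply]
  rw [h]
  refine mul_mem ?_ hg
  obtain ⟨d, x, rfl⟩ := hg
  cases d with
  | zero => rw [weylChar_zero, map_one]; exact one_mem _
  | succ d => rw [ratio_weylChar]; exact weylChar_mem _ _

/-- Each torsion argument is a power of z^(k+1)!, precisely where the relations defining 𝓗 determine
φ_{k+1} from φ₁(z). The factorial roots make P an integer polynomial. -/
theorem exists_weylChar_eq_zpow (d : ℕ) {x : ℕ → Circle}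
    (hx : ∀ k < d, IsOfFinOrder (x (k + 1))) : ∃ N > 0, ∃ z ∈ circleQ, z ^ N = 1 ∧
      ∃ P : Polynomial ℤ, ∀ (φ : weylSet) (m : ℤ), φ.1 1 z = z ^ m →
        weylChar (d + 1) x φ = x 0 * z ^ P.eval m := by
  obtain ⟨N, hN, z, hz, hzN, c, hc⟩ := exists_common_circleQ_root d hx
    (n := fun k => (k + 1).factorial) fun k => Nat.factorial_pos _
  refine ⟨N, hN, z, hz, hzN,
    ∑ k ∈ Finset.range d, descPochhammer ℤ (k + 1) * Polynomial.C (c k), fun φ m hm => ?_⟩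
  rw [weylChar_succ_apply, Polynomial.eval_finsetSum, ← prod_zpow_eq]
  congr 1
  refine Finset.prod_congr rfl fun k hk => ?_
  rw [hc k (Finset.mem_range.1 hk), map_zpow,
    ((mem_weylSet_iff φ.1).1 φ.2).2 z hz m hm (k + 1), ← zpow_mul, Polynomial.eval_mul,
    Polynomial.eval_C]

theorem sum_eq_of_periodic {E : Type*} [AddCommGroup E] {N : ℕ} {g : ℤ → E}
    (hg : ∀ m, g (m + N) = g m) (m : ℤ) :
    ∑ i ∈ Finset.range N, g (m + i) = ∑ i ∈ Finset.range N, g i := by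
  have h1 : Function.Periodic (fun m : ℤ => ∑ i ∈ Finset.range N, g (m + i)) 1 := by
    intro m
    have h2 := Finset.sum_range_succ (fun i : ℕ => g (m + i)) N
    rw [Finset.sum_range_succ', hg] at h2
    push_cast at h2
    rw [add_zero, add_left_inj] at h2
    refine Eq.trans ?_ h2
    exact Finset.sum_congr rfl fun i _ => by rw [add_assoc, add_comm 1]
  simpa using h1.int_mul m 0

/-- The point φ only selects the starting integer m; the N-periodic function g read along the orbit
is the same for all φ. -/
theorem exists_period_weylChar (d : ℕ) {x : ℕ → Circle}
    (hx : ∀ k < d, IsOfFinOrder (x (k + 1))) :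
    (∃ N > 0, ratio (weylHomeo^[N]) (weylChar (d + 1) x) = 1) ∧
      ∃ c, HasUniformMean weylHomeo (fun φ => (weylChar (d + 1) x φ : ℂ)) c := by
  obtain ⟨N, hN, z, hz, hzN, P, hP⟩ := exists_weylChar_eq_zpow d hx
  let g : ℤ → Circle := fun m => x 0 * z ^ P.eval m
  have hg : ∀ m, g (m + N) = g m := by
    intro m
    obtain ⟨q, hq⟩ := P.sub_dvd_eval_sub (m + N) m
    rw [add_sub_cancel_left, sub_eq_iff_eq_add] at hq
    simp only [g]
    rw [hq, zpow_add, zpow_mul, zpow_natCast, hzN, one_zpow, one_mul]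
  have horb : ∀ φ : weylSet, ∃ m : ℤ, ∀ n : ℕ,
      weylChar (d + 1) x (weylHomeo^[n] φ) = g (m + n) := by
    intro φ
    obtain ⟨m, hm⟩ := exists_apply_eq_zpow (φ.1 1) (isOfFinOrder_of_mem_circleQ hz)
    refine ⟨m, fun n => hP _ _ ?_⟩
    rw [iterate_weylHomeo_one_apply, hm, zpow_add, zpow_natCast, mul_comm]
  constructor
  · refine ⟨N, hN, ratio_eq_one_iff.2 fun φ => ?_⟩
    obtain ⟨m, hm⟩ := horb φ
    have h0 := hm 0
    rw [Nat.cast_zero, add_zero] at h0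
    rw [hm, hg, ← h0]
    rfl
  · refine ⟨_, hasUniformMean_of_periodic (C := 1) (fun φ => (Circle.norm_coe _).le) hN
      (c := ∑ i ∈ Finset.range N, (g i : ℂ)) fun φ => ?_⟩
    obtain ⟨m, hm⟩ := horb φ
    simp only [birkhoffSum, hm]
    exact sum_eq_of_periodic (g := fun m => (g m : ℂ)) (fun m => by rw [hg]) m

theorem ratio_iterate_mul_eq_one {X : Type*} {t : X → X} {M : ℕ} {g : X → Circle}
    (h : ratio (t^[M]) g = 1) (N : ℕ) : ratio (t^[M * N]) g = 1 := by
  rw [Function.iterate_mul, ratio_iterate_of_invariant h (map_one _), one_pow]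

/-- Taking a difference handles x₂, x₃, … by induction. Dividing out the resulting periodic factor
leaves φ₁(x₁) periodic, and T^n multiplies it by x₁^n, so x₁ is torsion too. -/
theorem isOfFinOrder_of_periodic_weylChar {M : ℕ} (hM : 0 < M) (d : ℕ) {x : ℕ → Circle}
    (h : ratio (weylHomeo^[M]) (weylChar (d + 1) x) = 1) :
    ∀ k < d, IsOfFinOrder (x (k + 1)) := by
  induction d generalizing x with
  | zero => exact fun k hk => absurd hk k.not_lt_zero
  | succ d ih =>
    have h1 : ∀ k < d, IsOfFinOrder (x (k + 1 + 1)) := by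
      refine ih (x := fun k => x (k + 1)) ?_
      rw [← ratio_weylChar,
        ← (ratio_commute (Function.Commute.self_iterate (weylHomeo : weylSet → weylSet) M)).eq, h,
        map_one]
    have h2 : IsOfFinOrder (x 1) := by
      let e : ℕ → Circle := Pi.mulSingle 1 (x 1)
      have he : ∀ φ, weylChar (d + 2) e φ = φ.1 1 (x 1) :=
        weylChar_mulSingle (by omega) (x 1)
      obtain ⟨⟨N, hN, hN1⟩, -⟩ := exists_period_weylChar (d + 1) (x := x * e⁻¹) (by
        intro k hk
        cases k with
        | zero => simp [e]
        | succ k => simpa [e, Pi.mulSingle_eq_of_ne] using h1 k (by omega))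
      have h3 : ratio (weylHomeo^[M * N]) (weylChar (d + 2) e) = 1 := by
        have h4 : weylChar (d + 2) e =
            weylChar (d + 2) x * (weylChar (d + 2) (x * e⁻¹))⁻¹ := by
          rw [← weylChar_inv, ← weylChar_mul]
          rw [mul_inv, inv_inv, mul_inv_cancel_left]
        rw [h4, map_mul, map_inv, ratio_iterate_mul_eq_one h N, mul_comm M N,
          ratio_iterate_mul_eq_one hN1 M, inv_one, mul_one]
      obtain ⟨φ⟩ := instNonemptyWeylSet
      have h5 := ratio_eq_one_iff.1 h3 φ
      rw [he, he, iterate_weylHomeo_one_apply, mul_eq_right] at h5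
      exact isOfFinOrder_iff_pow_eq_one.2 ⟨M * N, Nat.mul_pos hM hN, h5⟩
    intro k hk
    cases k with
    | zero => exact h2
    | succ k => exact h1 k (by omega)

theorem exists_hasUniformMean_weylChar {g : weylSet → Circle} (hg : g ∈ weylCharGroup) :
    ∃ c, HasUniformMean weylHomeo (fun φ => (g φ : ℂ)) c := by
  refine exists_hasUniformMean_of_subgroup (fun g hg => comp_weylHomeo_mem hg) ?_ ?_ hg
  · rintro _ ⟨d, x, rfl⟩
    exact ⟨d, 1, iterate_ratio_weylChar d x⟩
  · rintro _ ⟨d, x, rfl⟩ M hM h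
    cases d with
    | zero => exact ⟨_, by simpa [weylChar_zero] using hasUniformMean_const weylHomeo (1 : ℂ)⟩
    | succ d => exact (exists_period_weylChar d (isOfFinOrder_of_periodic_weylChar hM d h)).2

/-- Stone–Weierstrass: the characters form a group, so their span is already a star subalgebra, and
evaluations φ_k(x) separate points. -/
theorem dense_span_weylChar : Dense (Submodule.span ℂ
    {f : C(weylSet, ℂ) | ∃ g ∈ weylCharGroup, ∀ φ, f φ = (g φ : ℂ)} : Set C(weylSet, ℂ)) := by
  set S : Set C(weylSet, ℂ) := {f | ∃ g ∈ weylCharGroup, ∀ φ, f φ = (g φ : ℂ)} with hS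
  have hspan : Subalgebra.toSubmodule (Algebra.adjoin ℂ S) = Submodule.span ℂ S := by
    refine Algebra.adjoin_eq_span_of_subset _ fun f hf => Submodule.subset_span ?_
    refine Submonoid.closure_induction (fun _ => id) ?_ ?_ hf
    · exact ⟨1, one_mem _, fun φ => by simp⟩
    · rintro f f' - - ⟨g, hg, hfg⟩ ⟨g', hg', hfg'⟩
      exact ⟨g * g', mul_mem hg hg', fun φ => by
        rw [ContinuousMap.mul_apply, hfg, hfg', Pi.mul_apply, Circle.coe_mul]⟩
  let A : StarSubalgebra ℂ C(weylSet, ℂ) :=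
    { Algebra.adjoin ℂ S with
      star_mem' := by
        change Algebra.adjoin ℂ S ≤ star (Algebra.adjoin ℂ S)
        refine Algebra.adjoin_le ?_
        rintro f ⟨g, hg, hfg⟩
        refine Algebra.subset_adjoin ⟨g⁻¹, inv_mem hg, fun φ => ?_⟩
        rw [ContinuousMap.star_apply, hfg, Pi.inv_apply, Circle.coe_inv_eq_conj]
        rfl }
  have hsep : A.SeparatesPoints := by
    intro φ ψ hne
    obtain ⟨k, hk⟩ : ∃ k, φ.1 k ≠ ψ.1 k := by
      by_contra! h
      exact hne (Subtype.ext (funext h))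
    obtain ⟨x, hx⟩ : ∃ x, φ.1 k x ≠ ψ.1 k x := by
      by_contra! h
      exact hk (MonoidHom.ext h)
    let e : ℕ → Circle := Pi.mulSingle k x
    have he : ∀ φ, weylChar (k + 1) e φ = φ.1 k x := weylChar_mulSingle k.lt_succ_self x
    refine ⟨_, ⟨⟨fun φ => (weylChar (k + 1) e φ : ℂ),
      continuous_subtype_val.comp (continuous_weylChar _ _)⟩,
      Algebra.subset_adjoin ⟨_, weylChar_mem (k + 1) e, fun _ => rfl⟩, rfl⟩, ?_⟩
    simp only [ContinuousMap.coe_mk, he]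
    exact fun h => hx (Circle.coe_injective h)
  have htop := ContinuousMap.starSubalgebra_topologicalClosure_eq_top_of_separatesPoints A hsep
  rw [← hspan]
  intro f
  have hf : f ∈ A.topologicalClosure := htop ▸ StarSubalgebra.mem_top
  exact hf

theorem IsFactor.uniquelyErgodic {X : Type*} [TopologicalSpace X] [CompactSpace X] [T2Space X]
    [MeasurableSpace X] [BorelSpace X] {s : X ≃ₜ X} (h : IsFactor weylHomeo s) :
    UniquelyErgodic s := by
  obtain ⟨π, hπ, hsurj, hcomm⟩ := h
  have : Nonempty X := instNonemptyWeylSet.map π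
  refine uniquelyErgodic_of_hasUniformMean fun f => ?_
  obtain ⟨c, hc⟩ := exists_hasUniformMean_of_dense_span dense_span_weylChar (s := weylHomeo)
    (by
      rintro f ⟨g, hg, hfg⟩
      rw [show (f : weylSet → ℂ) = fun φ => (g φ : ℂ) from funext hfg]
      exact exists_hasUniformMean_weylChar hg)
    (f.comp ⟨π, hπ⟩)
  exact ⟨c, HasUniformMean.of_semiconj hsurj (fun φ => congrFun hcomm φ) hc⟩

end Weyl

end QuasiDiscrete

theorem mainTheorem9 :
    (∀ (X : Type*) [TopologicalSpace X] [CompactSpace X] [T2Space X]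
      [MeasurableSpace X] [BorelSpace X] (s : X ≃ₜ X),
      QuasiDiscrete.IsFactor QuasiDiscrete.weylHomeo s → QuasiDiscrete.UniquelyErgodic s) ∧
    (∀ (X : Type*) [TopologicalSpace X] [CompactSpace X] [T2Space X] [Nonempty X]
      [MeasurableSpace X] [BorelSpace X] (s : X ≃ₜ X),
      QuasiDiscrete.IsMinimalSystem s → QuasiDiscrete.HasQuasiDiscreteSpectrum s →
        QuasiDiscrete.UniquelyErgodic s) := by
  exact ⟨fun X _ _ _ _ _ s h => h.uniquelyErgodic,
    fun X _ _ _ _ _ _ s hs hd => hs.uniquelyErgodic hd⟩
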